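/- **Setting.** A *satisficing game* $\mathbb G$ consists of a finite state set $V$ with initial state $\mathbf v_0$, agents $\Omega=\{0,\dots,k-1\}$, finite action sets $A_0,\dots,A_{k-1}$ (decisions $D=A_0\times\dots\times A_{k-1}$), a transition function $\tau:V\times D\to V$, an integer discount factor $\gamma>1$, a reward function $\mathcal W:V\times D\to\mathbb Z^k$, and for each agent $i$ a goal $\langle\mathsf R_i,t_i\rangle$ with $\mathsf R_i\in\{<,\le,>,\ge,=,\ne\}$ and $t_i\in\mathbb Q$. A strategy of agent $i$ is a map $(V\times D)^*\times V\to A_i$; a profile $\pi$ of strategies determines a unique play $\rho_\pi=(\mathbf v_0,d_0),(v_1,d_1),\dots$ Agent $i$'s goal holds on a play $\rho=(v_n,d_n)_n$ if $R_i(\rho)\,\mathsf R_i\,t_i$, where $R_i(\rho)=\sum_{n\ge0}\mathcal W(v_n,d_n)[i]\,\gamma^{-n}$; agent $i$ strictly prefers the plays on which it holds to those on which it does not. A *$W$-NE*, for $W\subseteq\Omega$, is a Nash equilibrium in pure strategies $\pi$ such that $W$ is exactly the set of agents whose goal holds on $\rho_\pi$. **Comparators.** Let $\mu_i$ be the largest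 absolute value of a reward of agent $i$. A *comparator automaton* for agent $i$ is a finite complete deterministic Büchi automaton $A^i=\langle\{-\mu_i,\dots,\mu_i\},Q^i,q^i_0,\delta^i,F^i\rangle$ that accepts an infinite word $w$ iff $\big(\sum_n w_n\gamma^{-n}\big)\,\mathsf R_i\,t_i$, and that is a safety automaton (exactly one rejecting state, which is a sink) if $\mathsf R_i\in\{\le,\ge,=\}$ and a co-safety automaton (exactly one accepting state, which is a sink) otherwise. Let $\Omega_S$ and $\Omega_C$ be the sets of agents of the first and of the second kind. **The automaton $A_W$** reads words over $D$. Its states are the tuples $\langle v,q_0,\dots,q_{k-1},S_1,S_2\rangle$ with $v\in V$, $q_i\in Q^i$, $S_1,S_2\subseteq\Omega$; the initial state is $\langle\mathbf v_0,q^0_0,\dots,q^{k-1}_0,W\cap\Omega_C,\Omega_S\setminus W\rangle$. On $d\in D$ it moves to $\langle v',q'_0,\dots,q'_{k-1},S'_1,S'_2\rangle$ with $v'=\tau(v,d)$, $q'_i=\delta^i(q_i,\mathcal W(v,d)[i])$, $S'_1=\{i\in S_1: q'_i\notin F^i\}$, $S'_2=\{i\in S_2:q'_i\in F^i\}$, except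 that the move is undefined if $q'_i\notin F^i$ for some $i\in W\cap\Omega_S$ or $q'_i\in F^i$ for some $i\in\Omega_C\setminus W$. The accepting states are those with $S_1=S_2=\emptyset$ (Büchi acceptance). **The deviation game $G_j$** is a two-agent turn-based game. In a state $(v,q)\in V\times Q^j$ Agent 0 moves to $(v,q,d)$ for a $d\in D$ of his choice. In a state $(v,q,d)\in V\times Q^j\times D$ Agent 1 chooses $d'\in D$ that agrees with $d$ except possibly in the $j$-th coordinate, and moves to $(\tau(v,d'),\delta^j(q,\mathcal W(v,d')[j]))$. Let $C$ be the set of states whose $Q^j$-component is not in $F^j$. If $j\in\Omega_C$, Agent 0 wins a play iff it stays in $C$; if $j\in\Omega_S$, Agent 0 wins iff it visits $C$; Agent 1 wins otherwise. $\mathsf{Win}_1(G_j)$ is the set of states from which Agent 1 has a winning strategy. **The automaton $A'_W$** is obtained from $A_W$ by removing all states $\langle v,q_0,\dots,q_{k-1},S_1,S_2\rangle$ with $(v,q_j)\in\mathsf{Win}_1(G_j)$ for some $j\notin W$ and, in the remaining states, all transitions reading a $d$ with $(v,q_j,d)\in\mathsf{Win}_1(G_j)$ for some $j\notin W$. **Theorem.**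 Let $\mathbb G$ be a satisficing game and $W\subseteq\Omega$. Every agent has a comparator automaton, and for every choice of comparator automata $A^0,\dots,A^{k-1}$ of the agents, the language of the resulting automaton $A'_W$ is nonempty if and only if there exists a $W$-NE in $\mathbb G$. -/

import Mathlib

namespace Satisficing

universe u v w

/-! ### Büchi automata -/

/-- A (nondeterministic) Büchi automaton with finite alphabet `α` and finite state set `Q`. -/
structure BuchiAutomaton (α : Type u) (Q : Type v) [Finite α] [Finite Q] where
  start : Q
  trans : Q → α → Q → Prop
  accept : Set Q

namespace BuchiAutomaton

variable {α : Type u} {Q : Type v} [Finite α] [Finite Q]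

/-- `r` is a run of `M` over the infinite word `x`. -/
def IsRun (M : BuchiAutomaton α Q) (x : ℕ → α) (r : ℕ → Q) : Prop :=
  r 0 = M.start ∧ ∀ n, M.trans (r n) (x n) (r (n + 1))

/-- The set of states that occur infinitely often in a sequence of states. -/
def infSet (r : ℕ → Q) : Set Q := {q | ∃ᶠ n in Filter.atTop, r n = q}

/-- `M` has an accepting run over `x`. -/
def Accepts (M : BuchiAutomaton α Q) (x : ℕ → α) : Prop :=
  ∃ r : ℕ → Q, M.IsRun x r ∧ (infSet r ∩ M.accept).Nonempty

/-- The language of `M`. -/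
def language (M : BuchiAutomaton α Q) : Set (ℕ → α) := {x | M.Accepts x}

end BuchiAutomaton

/-- A deterministic Büchi automaton with a total transition function. -/
structure DetBuchi (α : Type u) (Q : Type v) [Finite α] [Finite Q] where
  start : Q
  step : Q → α → Q
  accept : Set Q

namespace DetBuchi

variable {α : Type u} {Q : Type v} [Finite α] [Finite Q]

/-- A deterministic Büchi automaton seen as a Büchi automaton. -/
def toBuchi (M : DetBuchi α Q) : BuchiAutomaton α Q where
  start := M.start
  trans q a q' := q' = M.step q a
  accept := M.accept

/-- Safety automaton: there is a single rejecting state, and it is a sink. -/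
def IsSafety (M : DetBuchi α Q) : Prop :=
  ∃ s : Q, M.accept = {s}ᶜ ∧ ∀ a, M.step s a = s

/-- Co-safety automaton: there is a single accepting state, and it is a sink. -/
def IsCoSafety (M : DetBuchi α Q) : Prop :=
  ∃ s : Q, M.accept = {s} ∧ ∀ a, M.step s a = s

end DetBuchi

/-! ### Discounted sums and comparator automata -/

/-- The six comparison relations `<, ≤, >, ≥, =, ≠`. -/
inductive CompRel where
  | lt | le | gt | ge | eq | ne

namespace CompRel

/-- The relation on the reals denoted by a comparison symbol. -/
def Holds : CompRel → ℝ → ℝ → Prop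
  | lt, x, y => x < y
  | le, x, y => x ≤ y
  | gt, x, y => x > y
  | ge, x, y => x ≥ y
  | eq, x, y => x = y
  | ne, x, y => x ≠ y

/-- The relations `≤, ≥, =`, whose comparators are safety automata;
those of `<, >, ≠` are co-safety automata. -/
def IsSafetyRel : CompRel → Prop
  | le => True
  | ge => True
  | eq => True
  | lt => False
  | gt => False
  | ne => False

end CompRel

/-- The discounted sum of an integer sequence; the series converges absolutely for the bounded
sequences and the discount factors `γ > 1` to which it is applied. -/
noncomputable def discountedSum (γ : ℕ) (x : ℕ → ℤ) : ℝ := ∑' n, (x n : ℝ) / (γ : ℝ) ^ n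

/-- The alphabet `{-μ, …, μ}`. -/
abbrev Weights (μ : ℕ) : Type := Set.Icc (-(μ : ℤ)) (μ : ℤ)

/-- `M` is a comparator automaton for the discounted sum with discount factor `γ`, upper bound `μ`,
relation `R` and threshold `t`: a safety automaton if `R` is one of `≤, ≥, =` and a co-safety
automaton otherwise, which accepts exactly the words whose discounted sum is in relation `R`
to `t`. -/
def IsComparator {Q : Type v} [Finite Q] (γ μ : ℕ) (R : CompRel) (t : ℚ)
    (M : DetBuchi (Weights μ) Q) : Prop :=
  (R.IsSafetyRel → M.IsSafety) ∧ (¬ R.IsSafetyRel → M.IsCoSafety) ∧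
    ∀ x : ℕ → Weights μ,
      M.toBuchi.Accepts x ↔ R.Holds (discountedSum γ fun n => (x n : ℤ)) (t : ℝ)

/-! ### Two-agent turn-based games with a reachability or a safety condition -/

/-- A reachability or safety condition of Agent 0; Agent 1 has the opposite goal. -/
inductive Condition (P : Type u) where
  | reach (C : Set P)
  | safe (C : Set P)

/-- The sequence of states `ρ` is winning for Agent 0. -/
def Condition.Wins₀ {P : Type u} : Condition P → (ℕ → P) → Prop
  | .reach C, ρ => ∃ n, ρ n ∈ C
  | .safe C, ρ => ∀ n, ρ n ∈ C

/-- A two-agent turn-based game; the states of Agent `0` are those of `P₀`, the states of Agent `1`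
are those of `P₁`. -/
structure TurnGame (P₀ : Type u) (P₁ : Type v) where
  edge : P₀ ⊕ P₁ → P₀ ⊕ P₁ → Prop
  cond : Condition (P₀ ⊕ P₁)

namespace TurnGame

variable {P₀ : Type u} {P₁ : Type v}

/-- Strategies of Agent 0: given the states visited before and the current state, which belongs to
Agent 0, choose a move along an edge. -/
def Strategy₀ (H : TurnGame P₀ P₁) : Type (max u v) :=
  {σ : List (P₀ ⊕ P₁) → P₀ → P₀ ⊕ P₁ // ∀ h p, H.edge (.inl p) (σ h p)}

/-- Strategies of Agent 1. -/
def Strategy₁ (H : TurnGame P₀ P₁) : Type (max u v) :=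
  {σ : List (P₀ ⊕ P₁) → P₁ → P₀ ⊕ P₁ // ∀ h p, H.edge (.inr p) (σ h p)}

/-- The next state after the visited states `h` and the current state. -/
def next (H : TurnGame P₀ P₁) (σ₀ : H.Strategy₀) (σ₁ : H.Strategy₁) (h : List (P₀ ⊕ P₁)) :
    P₀ ⊕ P₁ → P₀ ⊕ P₁
  | .inl p => σ₀.1 h p
  | .inr p => σ₁.1 h p

/-- The visited states (in chronological order) and the current state after `n` moves from `p`. -/
def config (H : TurnGame P₀ P₁) (σ₀ : H.Strategy₀) (σ₁ : H.Strategy₁) (p : P₀ ⊕ P₁) :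
    ℕ → List (P₀ ⊕ P₁) × (P₀ ⊕ P₁)
  | 0 => ([], p)
  | n + 1 =>
    let c := config H σ₀ σ₁ p n
    (c.1 ++ [c.2], H.next σ₀ σ₁ c.1 c.2)

/-- The play from `p` that results from a pair of strategies. -/
def play (H : TurnGame P₀ P₁) (σ₀ : H.Strategy₀) (σ₁ : H.Strategy₁) (p : P₀ ⊕ P₁) (n : ℕ) :
    P₀ ⊕ P₁ :=
  (H.config σ₀ σ₁ p n).2

/-- The states from which Agent 0 has a winning strategy. -/
def Win₀ (H : TurnGame P₀ P₁) : Set (P₀ ⊕ P₁) :=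
  {p | ∃ σ₀ : H.Strategy₀, ∀ σ₁ : H.Strategy₁, H.cond.Wins₀ (H.play σ₀ σ₁ p)}

/-- The states from which Agent 1 has a winning strategy. -/
def Win₁ (H : TurnGame P₀ P₁) : Set (P₀ ⊕ P₁) :=
  {p | ∃ σ₁ : H.Strategy₁, ∀ σ₀ : H.Strategy₀, ¬ H.cond.Wins₀ (H.play σ₀ σ₁ p)}

end TurnGame

/-! ### Satisficing games -/

/-- A multi-agent concurrent discounted-sum game with single-threshold satisficing goals and an
integral discount factor: states `V`, agents `0, …, k - 1`, actions `A i` of Agent `i`. -/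
structure SatisficingGame (V : Type u) (k : ℕ) (A : Fin k → Type v) where
  init : V
  τ : V → (∀ i, A i) → V
  γ : ℕ
  one_lt_γ : 1 < γ
  reward : V → (∀ i, A i) → Fin k → ℤ
  rel : Fin k → CompRel
  threshold : Fin k → ℚ

namespace SatisficingGame

variable {V : Type u} {k : ℕ} {A : Fin k → Type v}

/-- Strategies of Agent `i`: functions of the finite history (in chronological order) and the
current state. -/
abbrev Strategy (_ : SatisficingGame V k A) (i : Fin k) : Type (max u v) :=
  List (V × (∀ j, A j)) → V → A i

/-- Strategy profiles. -/
abbrev Profile (G : SatisficingGame V k A) : Type (max u v) := ∀ i, G.Strategy i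

/-- The history and the current state after `n` rounds in which the profile `π` is followed. -/
def config (G : SatisficingGame V k A) (π : G.Profile) : ℕ → List (V × (∀ j, A j)) × V
  | 0 => ([], G.init)
  | n + 1 =>
    let c := config G π n
    let d : ∀ j, A j := fun j => π j c.1 c.2
    (c.1 ++ [(c.2, d)], G.τ c.2 d)

/-- The primary trace of `π`: the play that results from `π`. -/
def primaryTrace (G : SatisficingGame V k A) (π : G.Profile) (n : ℕ) : V × (∀ j, A j) :=
  ((G.config π n).2, fun j => π j (G.config π n).1 (G.config π n).2)

/-- The cumulative reward of Agent `i` from a play. -/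
noncomputable def cumulativeReward (G : SatisficingGame V k A) (i : Fin k)
    (ρ : ℕ → V × (∀ j, A j)) : ℝ :=
  discountedSum G.γ fun n => G.reward (ρ n).1 (ρ n).2 i

/-- The goal of Agent `i` holds on a play. -/
def Satisfies (G : SatisficingGame V k A) (i : Fin k) (ρ : ℕ → V × (∀ j, A j)) : Prop :=
  (G.rel i).Holds (G.cumulativeReward i ρ) (G.threshold i : ℝ)

/-- Agent `i` strictly prefers the play `ρ'` to the play `ρ`. -/
def StrictlyPrefers (G : SatisficingGame V k A) (i : Fin k) (ρ' ρ : ℕ → V × (∀ j, A j)) : Prop :=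
  G.Satisfies i ρ' ∧ ¬ G.Satisfies i ρ

/-- `π` is a (pure-strategy) Nash equilibrium. -/
def IsNash (G : SatisficingGame V k A) (π : G.Profile) : Prop :=
  ∀ (i : Fin k) (σ : G.Strategy i),
    ¬ G.StrictlyPrefers i (G.primaryTrace (Function.update π i σ)) (G.primaryTrace π)

/-- The winning set of a play. -/
def winningSet (G : SatisficingGame V k A) (ρ : ℕ → V × (∀ j, A j)) : Set (Fin k) :=
  {i | G.Satisfies i ρ}

/-- `π` is a `W`-Nash equilibrium. -/
def IsWNash (G : SatisficingGame V k A) (W : Set (Fin k)) (π : G.Profile) : Prop :=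
  G.IsNash π ∧ G.winningSet (G.primaryTrace π) = W

/-- The agents whose goal has a safety comparator. -/
def safetyAgents (G : SatisficingGame V k A) : Set (Fin k) := {i | (G.rel i).IsSafetyRel}

/-- The agents whose goal has a co-safety comparator. -/
def cosafetyAgents (G : SatisficingGame V k A) : Set (Fin k) := {i | ¬ (G.rel i).IsSafetyRel}

variable [Fintype V] [∀ i, Fintype (A i)]

/-- The maximum magnitude of the rewards of Agent `i`. -/
def maxReward (G : SatisficingGame V k A) (i : Fin k) : ℕ :=
  Finset.univ.sup fun p : V × (∀ j, A j) => (G.reward p.1 p.2 i).natAbs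

theorem reward_mem (G : SatisficingGame V k A) (i : Fin k) (s : V) (d : ∀ j, A j) :
    G.reward s d i ∈ Set.Icc (-(G.maxReward i : ℤ)) (G.maxReward i : ℤ) := by
  have h : (G.reward s d i).natAbs ≤ G.maxReward i :=
    Finset.le_sup (f := fun p : V × (∀ j, A j) => (G.reward p.1 p.2 i).natAbs)
      (Finset.mem_univ (s, d))
  constructor <;> omega

/-- The reward of Agent `i`, as a letter of the alphabet of her comparator. -/
def letter (G : SatisficingGame V k A) (i : Fin k) (s : V) (d : ∀ j, A j) :
    Weights (G.maxReward i) :=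
  ⟨G.reward s d i, G.reward_mem i s d⟩

/-- `M` is a comparator automaton for the goal of Agent `i`. -/
def IsGoalComparator (G : SatisficingGame V k A) (i : Fin k) {Q : Type w} [Finite Q]
    (M : DetBuchi (Weights (G.maxReward i)) Q) : Prop :=
  IsComparator G.γ (G.maxReward i) (G.rel i) (G.threshold i) M

variable {Q : Fin k → Type w} [∀ i, Finite (Q i)]

/-- The edges of the deviation game of Agent `j`. Agent 0 proposes a decision, then Agent 1 may
change the action of Agent `j` in it. -/
def deviationEdge (G : SatisficingGame V k A)
    (B : ∀ i, DetBuchi (Weights (G.maxReward i)) (Q i)) (j : Fin k) :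
    (V × Q j) ⊕ (V × Q j × (∀ i, A i)) → (V × Q j) ⊕ (V × Q j × (∀ i, A i)) → Prop
  | .inl (s, q), .inr (s', q', _) => s' = s ∧ q' = q
  | .inr (s, q, d), .inl (s', q') =>
      ∃ d' : ∀ i, A i, (∀ i, i ≠ j → d' i = d i) ∧ G.τ s d' = s' ∧
        (B j).step q (G.letter j s d') = q'
  | _, _ => False

/-- The states of the deviation game whose automaton component is not accepting. -/
def deviationSet (G : SatisficingGame V k A)
    (B : ∀ i, DetBuchi (Weights (G.maxReward i)) (Q i)) (j : Fin k) :
    Set ((V × Q j) ⊕ (V × Q j × (∀ i, A i))) :=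
  {p | match p with
    | .inl (_, q) => q ∉ (B j).accept
    | .inr (_, q, _) => q ∉ (B j).accept}

open Classical in
/-- The deviation game `G_j`: Agent 0 plays for the agents other than `j`, against Agent `j`. -/
noncomputable def deviationGame (G : SatisficingGame V k A)
    (B : ∀ i, DetBuchi (Weights (G.maxReward i)) (Q i)) (j : Fin k) :
    TurnGame (V × Q j) (V × Q j × (∀ i, A i)) where
  edge := G.deviationEdge B j
  cond :=
    if j ∈ G.cosafetyAgents then .safe (G.deviationSet B j) else .reach (G.deviationSet B j)

/-- States `⟨s, q₀, …, q_{k-1}, S₁, S₂⟩` of the product automata. -/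
abbrev ProductState (V : Type u) {k : ℕ} (Q : Fin k → Type w) : Type (max u w) :=
  V × (∀ i, Q i) × Set (Fin k) × Set (Fin k)

/-- The automaton `A_W`, the product of the game with the comparators `B`. -/
def productAutomaton (G : SatisficingGame V k A)
    (B : ∀ i, DetBuchi (Weights (G.maxReward i)) (Q i)) (W : Set (Fin k)) :
    BuchiAutomaton (∀ i, A i) (ProductState V Q) where
  start := (G.init, fun i => (B i).start, W ∩ G.cosafetyAgents, Wᶜ ∩ G.safetyAgents)
  trans := fun (s, q, S₁, S₂) d (s', q', S₁', S₂') =>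
    s' = G.τ s d ∧
    (∀ i, q' i = (B i).step (q i) (G.letter i s d)) ∧
    S₁' = {i ∈ S₁ | q' i ∉ (B i).accept} ∧
    S₂' = {i ∈ S₂ | q' i ∈ (B i).accept} ∧
    (∀ i ∈ W ∩ G.safetyAgents, q' i ∈ (B i).accept) ∧
    (∀ i ∈ Wᶜ ∩ G.cosafetyAgents, q' i ∉ (B i).accept)
  accept := {p | p.2.2.1 = ∅ ∧ p.2.2.2 = ∅}

/-- The states of `A_W` that are kept in `A'_W`. -/
def allowedStates (G : SatisficingGame V k A)
    (B : ∀ i, DetBuchi (Weights (G.maxReward i)) (Q i)) (W : Set (Fin k)) :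
    Set (ProductState V Q) :=
  {p | ∀ j ∉ W, Sum.inl (p.1, p.2.1 j) ∉ (G.deviationGame B j).Win₁}

/-- The automaton `A'_W`. Removing a state means removing all transitions into it and out of it;
so there is no run at all if the initial state is removed. -/
def restrictedAutomaton (G : SatisficingGame V k A)
    (B : ∀ i, DetBuchi (Weights (G.maxReward i)) (Q i)) (W : Set (Fin k)) :
    BuchiAutomaton (∀ i, A i) (ProductState V Q) where
  start := (G.productAutomaton B W).start
  trans p d p' :=
    (G.productAutomaton B W).trans p d p' ∧
    p ∈ G.allowedStates B W ∧ p' ∈ G.allowedStates B W ∧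
    ∀ j ∉ W, Sum.inr (p.1, p.2.1 j, d) ∉ (G.deviationGame B j).Win₁
  accept := (G.productAutomaton B W).accept

end SatisficingGame

end Satisficing

/-!
Comparator automata exist because the gap between the threshold `a / b` and a partial discounted
sum, multiplied by `b * γ ^ n`, is an integer that is updated by `c ↦ γ * (c - b * w)`. Once its
absolute value exceeds the bound `γ * b * μ` on the scaled contribution of the remaining letters,
the comparison is decided and stays so; hence the gap can be clamped to a finite range, and the sum
equals the threshold iff the gap never reaches either end of it (`exists_comparator`).

The deviation game of an agent is a reachability game, for Agent 1 if the comparator is co-safety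
and for Agent 0 if it is safety. Such games are determined by positional strategies: the attractor
of the target carries a rank that its owner can decrease, and the opponent can stay outside it
(`IsAttractor.exists_positional`). So `Win₁` is an attractor or the complement of one, and in the
game itself both sides obtain positional moves, `exists_deviating_action` for the agent inside
`Win₁` and `exists_punishment` for the other agents outside it.

If the play of an equilibrium met `Win₁` for an agent `j ∉ W`, then `j` could follow the equilibrium
up to that point and then deviate so as to reach her goal (`exists_satisfying_deviation`). So the
play is an accepted word of the restricted automaton, whose sets `S₁` and `S₂` are eventually empty
because the comparators concerned fall into their sinks. Conversely, an accepted word is turned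
into a `trigger` profile: follow the word, and punish the first agent who departs from it. The play
of this profile makes exactly the goals of `W` true, and the agents outside `W` cannot gain since
a departure leads to a position outside `Win₁`, where the punishment is effective.
-/

namespace Satisficing
open Filter

/-! ### Runs of safety and co-safety automata -/

namespace BuchiAutomaton

/-- As there are finitely many states, some state of `S` recurs iff `S` as a whole is visited
infinitely often. -/
theorem infSet_inter_nonempty_iff {Q : Type*} [Finite Q] (r : ℕ → Q) (S : Set Q) :
    (infSet r ∩ S).Nonempty ↔ ∃ᶠ n in atTop, r n ∈ S := by
  constructor
  · rintro ⟨q, hq, hS⟩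
    exact Frequently.mono hq fun n hn => by rwa [hn]
  · intro h
    by_contra hne
    refine h ?_
    have : ∀ q : Q, ∀ᶠ n in atTop, ¬ (r n = q ∧ q ∈ S) := by
      intro q
      by_cases hq : q ∈ S
      · have : ¬ ∃ᶠ n in atTop, r n = q := fun hf => hne ⟨q, hf, hq⟩
        exact (not_frequently.1 this).mono fun n hn h => hn h.1
      · exact Eventually.of_forall fun n h => hq h.2
    exact (eventually_all.2 this).mono fun n hn h => hn (r n) ⟨rfl, h⟩

end BuchiAutomaton

namespace DetBuchi

variable {α Q : Type*} [Finite α] [Finite Q]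

/-- The unique run of a deterministic automaton over the word `x`. -/
def run (M : DetBuchi α Q) (x : ℕ → α) : ℕ → Q
  | 0 => M.start
  | n + 1 => M.step (run M x n) (x n)

theorem accepts_iff (M : DetBuchi α Q) (x : ℕ → α) :
    M.toBuchi.Accepts x ↔ ∃ᶠ n in atTop, M.run x n ∈ M.accept := by
  rw [← BuchiAutomaton.infSet_inter_nonempty_iff]
  constructor
  · rintro ⟨r, ⟨h0, hs⟩, hr⟩
    have : r = M.run x := by
      funext n
      induction n with
      | zero => exact h0
      | succ n ih => exact (hs n).trans (by rw [ih]; rfl)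
    exact this ▸ hr
  · intro h
    exact ⟨M.run x, ⟨rfl, fun n => rfl⟩, h⟩

theorem IsSafety.step_notMem {M : DetBuchi α Q} (h : M.IsSafety) {q : Q} (hq : q ∉ M.accept)
    (a : α) : M.step q a ∉ M.accept := by
  obtain ⟨s, hs, hsink⟩ := h
  simp only [hs, Set.mem_compl_iff, Set.mem_singleton_iff, not_not] at hq ⊢
  rw [hq, hsink]

theorem IsCoSafety.step_mem {M : DetBuchi α Q} (h : M.IsCoSafety) {q : Q} (hq : q ∈ M.accept)
    (a : α) : M.step q a ∈ M.accept := by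
  obtain ⟨s, hs, hsink⟩ := h
  simp only [hs, Set.mem_singleton_iff] at hq ⊢
  rw [hq, hsink]

theorem IsSafety.run_notMem {M : DetBuchi α Q} (h : M.IsSafety) {x : ℕ → α} {n m : ℕ}
    (hnm : n ≤ m) (hn : M.run x n ∉ M.accept) : M.run x m ∉ M.accept := by
  induction m, hnm using Nat.le_induction with
  | base => exact hn
  | succ m _ ih => exact h.step_notMem ih _

theorem IsCoSafety.run_mem {M : DetBuchi α Q} (h : M.IsCoSafety) {x : ℕ → α} {n m : ℕ}
    (hnm : n ≤ m) (hn : M.run x n ∈ M.accept) : M.run x m ∈ M.accept := by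
  induction m, hnm using Nat.le_induction with
  | base => exact hn
  | succ m _ ih => exact h.step_mem ih _

theorem IsSafety.accepts_iff {M : DetBuchi α Q} (h : M.IsSafety) (x : ℕ → α) :
    M.toBuchi.Accepts x ↔ ∀ n, M.run x n ∈ M.accept := by
  rw [DetBuchi.accepts_iff]
  refine ⟨fun hf n => ?_, fun hf => Frequently.of_forall hf⟩
  by_contra hn
  exact hf ((eventually_ge_atTop n).mono fun m hm => h.run_notMem hm hn)

theorem IsCoSafety.accepts_iff {M : DetBuchi α Q} (h : M.IsCoSafety) (x : ℕ → α) :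
    M.toBuchi.Accepts x ↔ ∃ n, M.run x n ∈ M.accept := by
  rw [DetBuchi.accepts_iff]
  refine ⟨fun hf => hf.exists, fun ⟨n, hn⟩ => Eventually.frequently ?_⟩
  exact (eventually_ge_atTop n).mono fun m hm => h.run_mem hm hn

/-! ### Trapping a set of states -/

open Classical in
/-- The automaton that follows the dynamics `start`, `step` on `S` and moves to the sink `none`
at the first visit to the set `K`. -/
noncomputable def trap {S : Type*} [Finite S] (start : S) (step : S → α → S) (K : Set S)
    (accept : Set (Option S)) : DetBuchi α (Option S) where
  start := if start ∈ K then none else some start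
  step
    | none, _ => none
    | some s, a => if step s a ∈ K then none else some (step s a)
  accept := accept

theorem exists_run_trap_eq_none_iff {S : Type*} [Finite S] (start : S) (step : S → α → S)
    (K : Set S) (accept : Set (Option S)) (x : ℕ → α) (r : ℕ → S) (h0 : r 0 = start)
    (hs : ∀ n, r (n + 1) = step (r n) (x n)) :
    (∃ n, (trap start step K accept).run x n = none) ↔ ∃ n, r n ∈ K := by
  have key : ∀ n, ((trap start step K accept).run x n = none ∧ ∃ m, r m ∈ K) ∨
      ((trap start step K accept).run x n = some (r n) ∧ r n ∉ K) := by
    intro n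
    induction n with
    | zero =>
      by_cases h : start ∈ K
      · exact .inl ⟨by simp [run, trap, h], 0, by rwa [h0]⟩
      · exact .inr ⟨by simp [run, trap, h, h0], by rwa [h0]⟩
    | succ n ih =>
      rcases ih with ⟨h, hm⟩ | ⟨h, -⟩
      · exact .inl ⟨by rw [run, h]; rfl, hm⟩
      · by_cases hK : r (n + 1) ∈ K
        · exact .inl ⟨by rw [run, h]; simp [trap, ← hs, hK], _, hK⟩
        · exact .inr ⟨by rw [run, h]; simp [trap, ← hs, hK], hK⟩
  constructor
  · rintro ⟨n, hn⟩
    rcases key n with ⟨-, h⟩ | ⟨h, -⟩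
    · exact h
    · simp [hn] at h
  · rintro ⟨n, hn⟩
    rcases key n with ⟨h, -⟩ | ⟨-, h⟩
    · exact ⟨n, h⟩
    · exact absurd hn h

/-- For any set `K` of states of a finite deterministic dynamics there are a safety automaton that
accepts the words whose orbit avoids `K` and a co-safety automaton that accepts the others. -/
theorem exists_safety_and_cosafety {S : Type} [Finite S] (start : S) (step : S → α → S)
    (orbit : (ℕ → α) → ℕ → S) (h0 : ∀ x, orbit x 0 = start)
    (hs : ∀ x n, orbit x (n + 1) = step (orbit x n) (x n)) (K : Set S) :
    (∃ M : DetBuchi α (Option S), M.IsSafety ∧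
      ∀ x, M.toBuchi.Accepts x ↔ ¬ ∃ n, orbit x n ∈ K) ∧
    (∃ M : DetBuchi α (Option S), M.IsCoSafety ∧
      ∀ x, M.toBuchi.Accepts x ↔ ∃ n, orbit x n ∈ K) := by
  constructor
  · have hM : (trap start step K {none}ᶜ).IsSafety := ⟨none, rfl, fun _ => rfl⟩
    refine ⟨_, hM, fun x => ?_⟩
    rw [hM.accepts_iff, ← exists_run_trap_eq_none_iff start step K {none}ᶜ x _ (h0 x) (hs x)]
    push Not
    exact Iff.rfl
  · have hM : (trap start step K {none}).IsCoSafety := ⟨none, rfl, fun _ => rfl⟩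
    refine ⟨_, hM, fun x => ?_⟩
    rw [hM.accepts_iff, ← exists_run_trap_eq_none_iff start step K {none} x _ (h0 x) (hs x)]
    exact Iff.rfl

end DetBuchi

/-! ### Comparator automata for discounted sums -/

/-- The gap between the threshold `a / b` and the first `n` terms of the discounted sum of `x`,
scaled by `b * γ ^ n` so that it is an integer. -/
def gap (γ : ℕ) (a b : ℤ) (x : ℕ → ℤ) : ℕ → ℤ
  | 0 => a
  | n + 1 => γ * (gap γ a b x n - b * x n)

section DiscountedSum

variable {γ μ : ℕ} {x : ℕ → ℤ}

theorem gap_eq (hγ : 1 < γ) (a b : ℤ) (x : ℕ → ℤ) (n : ℕ) :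
    (gap γ a b x n : ℝ) =
      (γ : ℝ) ^ n * (a - b * ∑ m ∈ Finset.range n, (x m : ℝ) / (γ : ℝ) ^ m) := by
  have hγ0 : (γ : ℝ) ≠ 0 := by positivity
  induction n with
  | zero => simp [gap]
  | succ n ih =>
    rw [gap, Finset.sum_range_succ]
    push_cast
    rw [ih]
    field_simp
    ring

theorem abs_term_le (hx : ∀ n, |x n| ≤ μ) (n : ℕ) :
    ‖(x n : ℝ) / (γ : ℝ) ^ n‖ ≤ μ * ((γ : ℝ)⁻¹) ^ n := by
  have : |(x n : ℝ)| ≤ μ := by exact_mod_cast hx n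
  rw [Real.norm_eq_abs, abs_div, abs_of_nonneg (by positivity : (0 : ℝ) ≤ (γ : ℝ) ^ n),
    div_eq_mul_inv, inv_pow]
  gcongr

theorem summable_majorant (hγ : 1 < γ) : Summable fun n => (μ : ℝ) * ((γ : ℝ)⁻¹) ^ n := by
  have h1 : (1 : ℝ) < γ := by exact_mod_cast hγ
  exact (summable_geometric_of_lt_one (by positivity) (inv_lt_one_of_one_lt₀ h1)).mul_left _

theorem hasSum_discountedSum (hγ : 1 < γ) (hx : ∀ n, |x n| ≤ μ) :
    HasSum (fun n => (x n : ℝ) / (γ : ℝ) ^ n) (discountedSum γ x) :=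
  (Summable.of_norm_bounded (summable_majorant hγ) (abs_term_le hx)).hasSum

theorem abs_discountedSum_sub_le (hγ : 1 < γ) (hx : ∀ n, |x n| ≤ μ) (n : ℕ) :
    |discountedSum γ x - ∑ m ∈ Finset.range n, (x m : ℝ) / (γ : ℝ) ^ m| ≤
      μ * γ / (γ : ℝ) ^ n := by
  have h2 : (2 : ℝ) ≤ γ := by exact_mod_cast hγ
  have hs := hasSum_discountedSum hγ hx
  have htail : discountedSum γ x - ∑ m ∈ Finset.range n, (x m : ℝ) / (γ : ℝ) ^ m =
      ∑' m, (x (m + n) : ℝ) / (γ : ℝ) ^ (m + n) := by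
    rw [discountedSum, ← hs.summable.sum_add_tsum_nat_add n]
    ring
  have hgeo : HasSum (fun m => (μ : ℝ) * ((γ : ℝ)⁻¹) ^ (m + n))
      (μ * ((γ : ℝ)⁻¹ ^ n * (1 - (γ : ℝ)⁻¹)⁻¹)) := by
    have := (hasSum_geometric_of_lt_one (r := (γ : ℝ)⁻¹) (by positivity)
      (inv_lt_one_of_one_lt₀ (by linarith))).mul_left ((μ : ℝ) * (γ : ℝ)⁻¹ ^ n)
    simpa only [pow_add, mul_assoc, mul_comm, mul_left_comm] using this
  have hle := tsum_of_norm_bounded hgeo fun m => abs_term_le (γ := γ) hx (m + n)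
  rw [htail]
  refine hle.trans ?_
  -- `1 / (1 - 1 / γ) = γ / (γ - 1) ≤ γ`
  have : (1 - (γ : ℝ)⁻¹)⁻¹ ≤ γ := by
    have hpos : (0 : ℝ) < γ := by linarith
    have : 1 - (γ : ℝ)⁻¹ = (γ - 1) / γ := by field_simp
    rw [this, inv_div, div_le_iff₀ (by linarith)]
    nlinarith
  calc (μ : ℝ) * ((γ : ℝ)⁻¹ ^ n * (1 - (γ : ℝ)⁻¹)⁻¹) ≤ μ * ((γ : ℝ)⁻¹ ^ n * γ) := by gcongr
    _ = μ * γ / (γ : ℝ) ^ n := by rw [inv_pow]; ring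

/-- Once the gap exceeds what the remaining terms can contribute, the sum stays below the
threshold. -/
theorem discountedSum_lt_of_gap (hγ : 1 < γ) (hx : ∀ n, |x n| ≤ μ) {a b : ℤ} (hb : 0 < b) {n : ℕ}
    (h : γ * b * μ < gap γ a b x n) : discountedSum γ x < (a : ℝ) / b := by
  have hb' : (0 : ℝ) < b := by exact_mod_cast hb
  have hγ' : (0 : ℝ) < (γ : ℝ) ^ n := by positivity
  have h' : (γ * b * μ : ℝ) < gap γ a b x n := by exact_mod_cast h
  rw [gap_eq hγ] at h'
  have hle := (abs_le.1 (abs_discountedSum_sub_le hγ hx n)).2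
  set p := ∑ m ∈ Finset.range n, (x m : ℝ) / (γ : ℝ) ^ m
  rw [le_div_iff₀ hγ'] at hle
  rw [lt_div_iff₀ hb']
  have h3 : (discountedSum γ x - p) * (γ : ℝ) ^ n * b ≤ μ * γ * b := by gcongr
  have : (γ : ℝ) ^ n * (discountedSum γ x * b) < (γ : ℝ) ^ n * a := by nlinarith
  exact lt_of_mul_lt_mul_left this hγ'.le

theorem lt_discountedSum_of_gap (hγ : 1 < γ) (hx : ∀ n, |x n| ≤ μ) {a b : ℤ} (hb : 0 < b) {n : ℕ}
    (h : gap γ a b x n < -(γ * b * μ)) : (a : ℝ) / b < discountedSum γ x := by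
  have hb' : (0 : ℝ) < b := by exact_mod_cast hb
  have hγ' : (0 : ℝ) < (γ : ℝ) ^ n := by positivity
  have h' : (gap γ a b x n : ℝ) < -(γ * b * μ) := by exact_mod_cast h
  rw [gap_eq hγ] at h'
  have hle := (abs_le.1 (abs_discountedSum_sub_le hγ hx n)).1
  set p := ∑ m ∈ Finset.range n, (x m : ℝ) / (γ : ℝ) ^ m
  rw [← neg_div, div_le_iff₀ hγ'] at hle
  rw [div_lt_iff₀ hb']
  have h3 : -(μ * γ) * (b : ℝ) ≤ (discountedSum γ x - p) * (γ : ℝ) ^ n * b := by gcongr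
  have : (γ : ℝ) ^ n * a < (γ : ℝ) ^ n * (discountedSum γ x * b) := by nlinarith
  exact lt_of_mul_lt_mul_left this hγ'.le

/-- A bounded gap forces equality, because the gap is scaled by `γ ^ n`. -/
theorem discountedSum_eq_of_gap (hγ : 1 < γ) (hx : ∀ n, |x n| ≤ μ) {a b N : ℤ} (hb : 0 < b)
    (h : ∀ n, |gap γ a b x n| ≤ N) : discountedSum γ x = (a : ℝ) / b := by
  have hb' : (0 : ℝ) < b := by exact_mod_cast hb
  have h1 : (1 : ℝ) < γ := by exact_mod_cast hγ
  refine tendsto_nhds_unique (hasSum_discountedSum hγ hx).tendsto_sum_nat ?_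
  have hlim : Tendsto (fun n : ℕ => (N : ℝ) / b * ((γ : ℝ)⁻¹) ^ n) atTop (nhds 0) := by
    have := (tendsto_pow_atTop_nhds_zero_of_lt_one (r := (γ : ℝ)⁻¹) (by positivity)
      (inv_lt_one_of_one_lt₀ h1)).const_mul ((N : ℝ) / b)
    simpa using this
  rw [tendsto_iff_norm_sub_tendsto_zero]
  refine squeeze_zero (fun _ => norm_nonneg _) (fun n => ?_) hlim
  have hn : |(gap γ a b x n : ℝ)| ≤ N := by exact_mod_cast h n
  rw [gap_eq hγ] at hn
  have hγ' : (0 : ℝ) < (γ : ℝ) ^ n := by positivity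
  set p := ∑ m ∈ Finset.range n, (x m : ℝ) / (γ : ℝ) ^ m
  have : p - (a : ℝ) / b = -((γ : ℝ) ^ n * (a - b * p)) / (b * (γ : ℝ) ^ n) := by
    field_simp
    ring
  rw [Real.norm_eq_abs, this, abs_div, abs_neg, abs_of_pos (by positivity : 0 < b * (γ : ℝ) ^ n)]
  calc _ ≤ (N : ℝ) / (b * (γ : ℝ) ^ n) := by gcongr
    _ = (N : ℝ) / b * ((γ : ℝ)⁻¹) ^ n := by rw [inv_pow]; field_simp

end DiscountedSum

/-- Clamping commutes with the dynamics of the gap, because `N` is large enough for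
the gap to stay beyond `N`, or below `-N`, once it is there. -/
theorem clamp_step {γ b μ N c w : ℤ} (hγ : 2 ≤ γ) (hb : 0 < b) (hμ : 0 ≤ μ)
    (hN : γ * b * μ < N) (hw : |w| ≤ μ) :
    max (-N) (min N (γ * (max (-N) (min N c) - b * w))) =
      max (-N) (min N (γ * (c - b * w))) := by
  have hN0 : 0 ≤ γ * b * μ := by positivity
  obtain ⟨hw1, hw2⟩ := abs_le.1 hw
  have h1 : γ * (b * w) ≤ γ * b * μ := by
    rw [mul_assoc]; gcongr
  have h2 : -(γ * b * μ) ≤ γ * (b * w) := by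
    have : γ * (b * (-μ)) ≤ γ * (b * w) := by gcongr
    linarith
  have hlo : ∀ y, y ≤ -N → max (-N) (min N y) = -N := fun y hy => by omega
  have hhi : ∀ y, N ≤ y → max (-N) (min N y) = N := fun y hy => by omega
  rcases le_total c (-N) with hc | hc
  · rw [hlo c hc, hlo _ (by nlinarith), hlo _ (by nlinarith)]
  · rcases le_total N c with hc' | hc'
    · rw [hhi c hc', hhi _ (by nlinarith), hhi _ (by nlinarith)]
    · rw [min_eq_right hc', max_eq_right hc]

/-- The automaton runs on the gap, clamped to `[-N, N]`. The sum is less than the threshold iff the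
gap reaches `N`, greater iff it reaches `-N`, and equal iff neither happens. -/
theorem exists_comparator {γ : ℕ} (hγ : 1 < γ) (μ : ℕ) (R : CompRel) (t : ℚ) :
    ∃ (S : Type) (_ : Finite S) (M : DetBuchi (Weights μ) S), IsComparator γ μ R t M := by
  let a : ℤ := t.num
  let b : ℤ := (t.den : ℤ)
  have hb : 0 < b := Int.natCast_pos.2 t.den_pos
  have ht : (t : ℝ) = (a : ℝ) / b := by
    rw [Rat.cast_def]; simp [a, b]
  let N : ℤ := γ * b * μ + 1
  have hNpos : 0 < N := by positivity
  have hNle : -N ≤ N := by linarith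
  have hx : ∀ (x : ℕ → Weights μ) n, |(x n : ℤ)| ≤ μ := fun x n => abs_le.2 (x n).2
  let c : (ℕ → Weights μ) → ℕ → ℤ := fun x => gap γ a b fun n => (x n : ℤ)
  let orbit : (ℕ → Weights μ) → ℕ → Set.Icc (-N) N := fun x n => Set.projIcc (-N) N hNle (c x n)
  let step : Set.Icc (-N) N → Weights μ → Set.Icc (-N) N :=
    fun s w => Set.projIcc (-N) N hNle (γ * (s - b * w))
  have aut := DetBuchi.exists_safety_and_cosafety (α := Weights μ) (Set.projIcc (-N) N hNle a) step
    orbit (fun x => rfl) (fun x n => by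
      refine Subtype.ext ?_
      simp only [orbit, step, c, Set.coe_projIcc, gap]
      exact (clamp_step (by exact_mod_cast hγ) hb (Int.natCast_nonneg μ) (by linarith)
        (hx x n)).symm)
  -- `U` and `L` consist of the upper and of the lower end of the range.
  let U : Set (Set.Icc (-N) N) := {s | (s : ℤ) = N}
  let L : Set (Set.Icc (-N) N) := {s | (s : ℤ) = -N}
  have hU : ∀ x n, orbit x n ∈ U ↔ N ≤ c x n := by
    intro x n
    simp only [orbit, U, Set.mem_ofPred_eq, Set.coe_projIcc]
    grind
  have hL : ∀ x n, orbit x n ∈ L ↔ c x n ≤ -N := by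
    intro x n
    simp only [orbit, L, Set.mem_ofPred_eq, Set.coe_projIcc]
    grind
  let s : (ℕ → Weights μ) → ℝ := fun x => discountedSum γ fun n => (x n : ℤ)
  have hlt : ∀ x, (∃ n, orbit x n ∈ U) → s x < t := by
    rintro x ⟨n, hn⟩
    rw [ht]
    exact discountedSum_lt_of_gap hγ (hx x) hb
      (by have := (hU x n).1 hn; simp only [c] at this; linarith)
  have hgt : ∀ x, (∃ n, orbit x n ∈ L) → (t : ℝ) < s x := by
    rintro x ⟨n, hn⟩
    rw [ht]
    exact lt_discountedSum_of_gap hγ (hx x) hb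
      (by have := (hL x n).1 hn; simp only [c] at this; linarith)
  have heq : ∀ x, (¬ ∃ n, orbit x n ∈ U) → (¬ ∃ n, orbit x n ∈ L) → s x = t := by
    intro x h1 h2
    rw [ht]
    refine discountedSum_eq_of_gap (N := N) hγ (hx x) hb fun n => abs_le.2 ⟨?_, ?_⟩
    · exact (not_le.1 fun h => h2 ⟨n, (hL x n).2 h⟩).le
    · exact (not_le.1 fun h => h1 ⟨n, (hU x n).2 h⟩).le
  have hUlt : ∀ x, (∃ n, orbit x n ∈ U) ↔ s x < t := by
    intro x
    refine ⟨hlt x, fun h => ?_⟩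
    by_contra h1
    by_cases h2 : ∃ n, orbit x n ∈ L
    · exact lt_asymm h (hgt x h2)
    · exact h.ne (heq x h1 h2)
  have hLgt : ∀ x, (∃ n, orbit x n ∈ L) ↔ (t : ℝ) < s x := by
    intro x
    refine ⟨hgt x, fun h => ?_⟩
    by_contra h1
    by_cases h2 : ∃ n, orbit x n ∈ U
    · exact lt_asymm h (hlt x h2)
    · exact h.ne' (heq x h2 h1)
  have hULne : ∀ x, (∃ n, orbit x n ∈ U ∪ L) ↔ s x ≠ t := by
    intro x
    simp only [Set.mem_union, exists_or]
    rw [hUlt, hLgt, ← lt_or_lt_iff_ne]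
  cases R with
  | lt =>
    obtain ⟨M, hM, h⟩ := (aut U).2
    exact ⟨_, inferInstance, M, fun h => h.elim, fun _ => hM, fun x => (h x).trans (hUlt x)⟩
  | gt =>
    obtain ⟨M, hM, h⟩ := (aut L).2
    exact ⟨_, inferInstance, M, fun h => h.elim, fun _ => hM, fun x => (h x).trans (hLgt x)⟩
  | ne =>
    obtain ⟨M, hM, h⟩ := (aut (U ∪ L)).2
    exact ⟨_, inferInstance, M, fun h => h.elim, fun _ => hM, fun x => (h x).trans (hULne x)⟩
  | le =>
    obtain ⟨M, hM, h⟩ := (aut L).1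
    exact ⟨_, inferInstance, M, fun _ => hM, fun h => (h trivial).elim, fun x =>
      (h x).trans ((not_congr (hLgt x)).trans not_lt)⟩
  | ge =>
    obtain ⟨M, hM, h⟩ := (aut U).1
    exact ⟨_, inferInstance, M, fun _ => hM, fun h => (h trivial).elim, fun x =>
      (h x).trans ((not_congr (hUlt x)).trans not_lt)⟩
  | eq =>
    obtain ⟨M, hM, h⟩ := (aut (U ∪ L)).1
    exact ⟨_, inferInstance, M, fun _ => hM, fun h => (h trivial).elim, fun x =>
      (h x).trans ((not_congr (hULne x)).trans not_not)⟩

/-! ### Attractors and the winning region of Agent 1 -/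

/-- `T` is the attractor of `C` for the player who moves in the positions of `O`, with `r` the
distance to `C`: from `T` that player can enforce a visit to `C`, as she can decrease `r` and her
opponent has to; outside `T` her opponent can stay outside `T`. -/
structure IsAttractor {P : Type*} (edge : P → P → Prop) (O C T : Set P) (r : P → ℕ) : Prop where
  subset : C ⊆ T
  exists_edge : ∀ p ∈ T, p ∉ C → p ∈ O → ∃ p', edge p p' ∧ p' ∈ T ∧ r p' < r p
  forall_edge : ∀ p ∈ T, p ∉ C → p ∉ O → ∀ p', edge p p' → p' ∈ T ∧ r p' < r p
  forall_edge_notMem : ∀ p ∉ T, p ∈ O → ∀ p', edge p p' → p' ∉ T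
  exists_edge_notMem : ∀ p ∉ T, p ∉ O → ∃ p', edge p p' ∧ p' ∉ T

/-- The positions from which the player who moves in `O` can enforce a visit to `C` within `n`
moves. -/
def attractorLayer {P : Type*} (edge : P → P → Prop) (O C : Set P) : ℕ → Set P
  | 0 => C
  | n + 1 => attractorLayer edge O C n ∪
      {p | (p ∈ O ∧ ∃ p', edge p p' ∧ p' ∈ attractorLayer edge O C n) ∨
        (p ∉ O ∧ ∀ p', edge p p' → p' ∈ attractorLayer edge O C n)}

theorem exists_isAttractor {P : Type*} [Finite P] (edge : P → P → Prop) (O C : Set P) :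
    ∃ (T : Set P) (r : P → ℕ), IsAttractor edge O C T r := by
  classical
  let L := attractorLayer edge O C
  have hmono : Monotone L := monotone_nat_of_le_succ fun n => Set.subset_union_left
  let r : P → ℕ := fun p => sInf {n | p ∈ L n}
  have hr : ∀ {p n}, p ∈ L n → p ∈ L (r p) :=
    fun {p n} h => Nat.sInf_mem (s := {n | p ∈ L n}) ⟨n, h⟩
  have hle : ∀ {p n}, p ∈ L n → r p ≤ n := fun {p n} h => Nat.sInf_le h
  -- A position of the attractor outside `C` entered it at a successor layer.
  have hlast : ∀ p ∈ ⋃ n, L n, p ∉ C → ∃ m, r p = m + 1 ∧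
      ((p ∈ O ∧ ∃ p', edge p p' ∧ p' ∈ L m) ∨ (p ∉ O ∧ ∀ p', edge p p' → p' ∈ L m)) := by
    intro p hp hC
    obtain ⟨n, hn⟩ := Set.mem_iUnion.1 hp
    have hmem := hr hn
    cases hrp : r p with
    | zero => rw [hrp] at hmem; exact absurd hmem hC
    | succ m =>
      rw [hrp] at hmem
      refine ⟨m, rfl, hmem.resolve_left fun h => ?_⟩
      have := hle h
      omega
  refine ⟨⋃ n, L n, r, ⟨?_, ?_, ?_, ?_, ?_⟩⟩
  · exact Set.subset_iUnion L 0
  · intro p hp hC hO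
    obtain ⟨m, hm, ⟨-, p', he, hp'⟩ | ⟨h, -⟩⟩ := hlast p hp hC
    · exact ⟨p', he, Set.mem_iUnion.2 ⟨m, hp'⟩, by have := hle hp'; omega⟩
    · exact absurd hO h
  · intro p hp hC hO p' he
    obtain ⟨m, hm, ⟨h, -⟩ | ⟨-, h⟩⟩ := hlast p hp hC
    · exact absurd h hO
    · exact ⟨Set.mem_iUnion.2 ⟨m, h p' he⟩, by have := hle (h p' he); omega⟩
  · intro p hp hO p' he hp'
    obtain ⟨n, hn⟩ := Set.mem_iUnion.1 hp'
    exact hp (Set.mem_iUnion.2 ⟨n + 1, .inr (.inl ⟨hO, p', he, hn⟩)⟩)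
  · intro p hp hO
    by_contra! h
    -- As `P` is finite, all successors lie in a common layer.
    obtain ⟨n, hn⟩ := (Set.finite_range r).bddAbove
    refine hp (Set.mem_iUnion.2 ⟨n + 1, .inr (.inr ⟨hO, fun p' he => ?_⟩)⟩)
    obtain ⟨m, hm⟩ := Set.mem_iUnion.1 (h p' he)
    exact hmono (hn ⟨p', rfl⟩) (hr hm)

/-- The attractor is won by a positional strategy of its owner, and its complement by one of
the opponent; one function `f` gives the moves of both. -/
theorem IsAttractor.exists_positional {P : Type*} {edge : P → P → Prop} {O C T : Set P} {r : P → ℕ}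
    (h : IsAttractor edge O C T r) (hedge : ∀ p, ∃ p', edge p p') :
    ∃ f : P → P, (∀ p, edge p (f p)) ∧
      ∀ ρ : ℕ → P, (∀ n, edge (ρ n) (ρ (n + 1))) →
        ((∀ n, ρ n ∈ O → ρ (n + 1) = f (ρ n)) → ρ 0 ∈ T → ∃ n, ρ n ∈ C) ∧
        ((∀ n, ρ n ∉ O → ρ (n + 1) = f (ρ n)) → ρ 0 ∉ T → ∀ n, ρ n ∉ C) := by
  have : ∀ p, ∃ p', edge p p' ∧ (p ∈ T → p ∉ C → p ∈ O → p' ∈ T ∧ r p' < r p) ∧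
      (p ∉ T → p ∉ O → p' ∉ T) := by
    intro p
    by_cases h1 : p ∈ T ∧ p ∉ C ∧ p ∈ O
    · obtain ⟨p', he, hp'⟩ := h.exists_edge p h1.1 h1.2.1 h1.2.2
      exact ⟨p', he, fun _ _ _ => hp', fun hT => absurd h1.1 hT⟩
    · by_cases h2 : p ∉ T ∧ p ∉ O
      · obtain ⟨p', he, hp'⟩ := h.exists_edge_notMem p h2.1 h2.2
        exact ⟨p', he, fun hT => absurd hT h2.1, fun _ _ => hp'⟩
      · obtain ⟨p', he⟩ := hedge p
        exact ⟨p', he, fun a b c => absurd ⟨a, b, c⟩ h1, fun a b => absurd ⟨a, b⟩ h2⟩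
  choose f hf hT hF using this
  refine ⟨f, hf, fun ρ hρ => ⟨fun hO h0 => ?_, fun hO h0 => ?_⟩⟩
  · by_contra! hC
    have hstep : ∀ n, ρ n ∈ T → ρ (n + 1) ∈ T ∧ r (ρ (n + 1)) < r (ρ n) := by
      intro n hn
      by_cases hn' : ρ n ∈ O
      · rw [hO n hn']
        exact hT _ hn (hC n) hn'
      · exact h.forall_edge _ hn (hC n) hn' _ (hρ n)
    have hmem : ∀ n, ρ n ∈ T := fun n => Nat.rec h0 (fun n ih => (hstep n ih).1) n
    exact not_strictAnti_of_wellFoundedLT (fun n => r (ρ n))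
      (strictAnti_nat_of_succ_lt fun n => (hstep n (hmem n)).2)
  · have hmem : ∀ n, ρ n ∉ T := by
      intro n
      induction n with
      | zero => exact h0
      | succ n ih =>
        by_cases hn' : ρ n ∈ O
        · exact h.forall_edge_notMem _ ih hn' _ (hρ n)
        · rw [hO n hn']
          exact hF _ ih hn'
    exact fun n hn => hmem n (h.subset hn)

namespace TurnGame

variable {P₀ P₁ : Type*}

theorem edge_play (H : TurnGame P₀ P₁) (σ₀ : H.Strategy₀) (σ₁ : H.Strategy₁) (p : P₀ ⊕ P₁) (n : ℕ) :
    H.edge (H.play σ₀ σ₁ p n) (H.play σ₀ σ₁ p (n + 1)) := by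
  have : H.play σ₀ σ₁ p (n + 1) =
      H.next σ₀ σ₁ (H.config σ₀ σ₁ p n).1 (H.play σ₀ σ₁ p n) := rfl
  rw [this]
  cases H.play σ₀ σ₁ p n with
  | inl q => exact σ₀.2 _ q
  | inr q => exact σ₁.2 _ q

theorem play_succ_of_inl (H : TurnGame P₀ P₁) {f : P₀ ⊕ P₁ → P₀ ⊕ P₁} (hf : ∀ p, H.edge p (f p))
    (σ₁ : H.Strategy₁) (p : P₀ ⊕ P₁) (n : ℕ) :
    let ρ := H.play ⟨fun _ q => f (.inl q), fun _ _ => hf _⟩ σ₁ p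
    ρ n ∈ Set.range Sum.inl → ρ (n + 1) = f (ρ n) := by
  rintro ρ ⟨q, hq⟩
  have : ρ (n + 1) = H.next _ σ₁ (H.config _ σ₁ p n).1 (ρ n) := rfl
  rw [this, ← hq]
  rfl

theorem play_succ_of_inr (H : TurnGame P₀ P₁) {f : P₀ ⊕ P₁ → P₀ ⊕ P₁} (hf : ∀ p, H.edge p (f p))
    (σ₀ : H.Strategy₀) (p : P₀ ⊕ P₁) (n : ℕ) :
    let ρ := H.play σ₀ ⟨fun _ q => f (.inr q), fun _ _ => hf _⟩ p
    ρ n ∈ Set.range Sum.inr → ρ (n + 1) = f (ρ n) := by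
  rintro ρ ⟨q, hq⟩
  have : ρ (n + 1) = H.next σ₀ _ (H.config σ₀ _ p n).1 (ρ n) := rfl
  rw [this, ← hq]
  rfl

variable [Finite P₀] [Finite P₁]

/-- Determinacy of safety games. -/
theorem exists_isAttractor_win₁_of_safe (H : TurnGame P₀ P₁) (hedge : ∀ p, ∃ p', H.edge p p')
    {C : Set (P₀ ⊕ P₁)} (hC : H.cond = .safe C) :
    ∃ r, IsAttractor H.edge (Set.range Sum.inr) Cᶜ H.Win₁ r := by
  obtain ⟨T, r, h⟩ := exists_isAttractor H.edge (Set.range Sum.inr) Cᶜ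
  obtain ⟨f, hf, hρ⟩ := h.exists_positional hedge
  suffices H.Win₁ = T from ⟨r, this ▸ h⟩
  ext p
  constructor
  · rintro ⟨σ₁, hσ₁⟩
    by_contra hp
    refine hσ₁ ⟨fun _ q => f (.inl q), fun _ _ => hf _⟩ ?_
    rw [hC]
    intro n
    refine not_not.1 ((hρ _ (H.edge_play _ _ p)).2 (fun m hm => ?_) hp n)
    exact H.play_succ_of_inl hf _ _ _ (Set.compl_range_inr.subset hm)
  · intro hp
    refine ⟨⟨fun _ q => f (.inr q), fun _ _ => hf _⟩, fun σ₀ hw => ?_⟩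
    rw [hC] at hw
    obtain ⟨n, hn⟩ := (hρ _ (H.edge_play _ _ p)).1
      (fun m hm => H.play_succ_of_inr hf σ₀ p m hm) hp
    exact hn (hw n)

/-- Determinacy of reachability games. -/
theorem exists_isAttractor_win₁_of_reach (H : TurnGame P₀ P₁) (hedge : ∀ p, ∃ p', H.edge p p')
    {C : Set (P₀ ⊕ P₁)} (hC : H.cond = .reach C) :
    ∃ r, IsAttractor H.edge (Set.range Sum.inl) C H.Win₁ᶜ r := by
  obtain ⟨T, r, h⟩ := exists_isAttractor H.edge (Set.range Sum.inl) C
  obtain ⟨f, hf, hρ⟩ := h.exists_positional hedge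
  suffices H.Win₁ᶜ = T from ⟨r, this ▸ h⟩
  ext p
  constructor
  · intro hp
    by_contra hT
    refine hp ⟨⟨fun _ q => f (.inr q), fun _ _ => hf _⟩, fun σ₀ hw => ?_⟩
    rw [hC] at hw
    obtain ⟨n, hn⟩ := hw
    refine (hρ _ (H.edge_play _ _ p)).2 (fun m hm => ?_) hT n hn
    exact H.play_succ_of_inr hf _ _ _ (Set.compl_range_inl.subset hm)
  · rintro hp ⟨σ₁, hσ₁⟩
    refine hσ₁ ⟨fun _ q => f (.inl q), fun _ _ => hf _⟩ ?_
    rw [hC]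
    exact (hρ _ (H.edge_play _ _ p)).1 (fun m hm => H.play_succ_of_inl hf σ₁ p m hm) hp

end TurnGame

namespace SatisficingGame

universe u v w

variable {V : Type u} {k : ℕ} {A : Fin k → Type v}

/-! ### Histories and the first departure from a sequence of decisions -/

theorem length_config {G : SatisficingGame V k A} (π : G.Profile) (n : ℕ) :
    (G.config π n).1.length = n := by
  induction n with
  | zero => rfl
  | succ n ih => simp [config, ih]

open Classical in
/-- The agent who is held responsible for the first departure from the decisions `x` in a history,
which is given in reverse chronological order; `none` if there is no departure. -/
noncomputable def deviatorRev (x : ℕ → ∀ i, A i) : List (V × (∀ i, A i)) → Option (Fin k)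
  | [] => none
  | e :: h =>
    match deviatorRev x h with
    | some j => some j
    | none => if H : ∃ j, e.2 j ≠ x h.length j then some H.choose else none

/-- The agent who is held responsible for the first departure from the decisions `x` in a history
in chronological order. If several agents depart at once, an arbitrary one of them is chosen. -/
noncomputable def deviator (x : ℕ → ∀ i, A i) (h : List (V × (∀ i, A i))) : Option (Fin k) :=
  deviatorRev x h.reverse

section Deviator

variable {x : ℕ → ∀ i, A i} {h : List (V × (∀ i, A i))} {e : V × (∀ i, A i)} {j : Fin k}

theorem deviator_append_of_some (hj : deviator x h = some j) :
    deviator x (h ++ [e]) = some j := by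
  unfold deviator at hj ⊢
  simp [deviatorRev, hj]

theorem deviator_append_of_eq (hn : deviator x h = none) (he : e.2 = x h.length) :
    deviator x (h ++ [e]) = none := by
  unfold deviator at hn ⊢
  simp [deviatorRev, hn, he]

theorem deviator_append_of_ne (hn : deviator x h = none) (he : e.2 ≠ x h.length)
    (hj : ∀ i, i ≠ j → e.2 i = x h.length i) : deviator x (h ++ [e]) = some j := by
  unfold deviator at hn ⊢
  have H : ∃ i, e.2 i ≠ x h.length i := Function.ne_iff.1 he
  have hc : H.choose = j := not_not.1 fun hne => H.choose_spec (hj _ hne)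
  simp [deviatorRev, hn, H, hc]

end Deviator

variable [Fintype V] [∀ i, Fintype (A i)] {Q : Fin k → Type w} [∀ i, Finite (Q i)]
  {G : SatisficingGame V k A} {B : ∀ i, DetBuchi (Weights (G.maxReward i)) (Q i)}

/-! ### The winning region of the deviation game -/

section DeviationGame

variable {j : Fin k}

theorem IsGoalComparator.isSafety (hB : G.IsGoalComparator j (B j)) (hj : j ∉ G.cosafetyAgents) :
    (B j).IsSafety :=
  hB.1 (not_not.1 hj)

theorem IsGoalComparator.isCoSafety (hB : G.IsGoalComparator j (B j)) (hj : j ∈ G.cosafetyAgents) :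
    (B j).IsCoSafety :=
  hB.2.1 hj

theorem exists_deviationEdge [Nonempty (∀ i, A i)] (p : (V × Q j) ⊕ (V × Q j × (∀ i, A i))) :
    ∃ p', G.deviationEdge B j p p' := by
  rcases p with ⟨s, q⟩ | ⟨s, q, d⟩
  · exact ⟨.inr (s, q, Classical.arbitrary _), rfl, rfl⟩
  · exact ⟨.inl (G.τ s d, (B j).step q (G.letter j s d)), d, fun _ _ => rfl, rfl, rfl⟩

theorem exists_isAttractor_of_cosafety [Nonempty (∀ i, A i)] (hj : j ∈ G.cosafetyAgents) :
    ∃ r, IsAttractor (G.deviationEdge B j) (Set.range Sum.inr) (G.deviationSet B j)ᶜ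
      (G.deviationGame B j).Win₁ r :=
  (G.deviationGame B j).exists_isAttractor_win₁_of_safe exists_deviationEdge (if_pos hj)

theorem exists_isAttractor_of_safety [Nonempty (∀ i, A i)] (hj : j ∉ G.cosafetyAgents) :
    ∃ r, IsAttractor (G.deviationEdge B j) (Set.range Sum.inl) (G.deviationSet B j)
      (G.deviationGame B j).Win₁ᶜ r :=
  (G.deviationGame B j).exists_isAttractor_win₁_of_reach exists_deviationEdge (if_neg hj)

/-- This also holds in positions where the goal of `j` is already decided, because the deciding
states of her comparator are sinks. -/
theorem notMem_win₁_of_inr [Nonempty (∀ i, A i)] (hB : G.IsGoalComparator j (B j)) {s : V} {q : Q j}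
    {d d' : ∀ i, A i} (h : Sum.inr (s, q, d) ∉ (G.deviationGame B j).Win₁)
    (hd : ∀ i, i ≠ j → d' i = d i) :
    Sum.inl (G.τ s d', (B j).step q (G.letter j s d')) ∉ (G.deviationGame B j).Win₁ := by
  by_cases hj : j ∈ G.cosafetyAgents
  · obtain ⟨r, hr⟩ := exists_isAttractor_of_cosafety (B := B) hj
    exact hr.forall_edge_notMem _ h ⟨_, rfl⟩ _ ⟨d', hd, rfl, rfl⟩
  · obtain ⟨r, hr⟩ := exists_isAttractor_of_safety (B := B) hj
    by_cases hq : q ∈ (B j).accept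
    · exact (hr.forall_edge _ h (not_not.2 hq) (by simp)
        (.inl (G.τ s d', (B j).step q (G.letter j s d'))) ⟨d', hd, rfl, rfl⟩).1
    · exact hr.subset (a := Sum.inl (_, _)) ((hB.isSafety hj).step_notMem hq _)

theorem mem_win₁_of_inl [Nonempty (∀ i, A i)] {s : V} {q : Q j}
    (h : Sum.inl (s, q) ∈ (G.deviationGame B j).Win₁) (d : ∀ i, A i) :
    Sum.inr (s, q, d) ∈ (G.deviationGame B j).Win₁ := by
  by_cases hj : j ∈ G.cosafetyAgents
  · obtain ⟨r, hr⟩ := exists_isAttractor_of_cosafety (B := B) hj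
    by_cases hq : q ∈ (B j).accept
    · exact hr.subset (a := Sum.inr (_, _, _)) (not_not.2 hq)
    · exact (hr.forall_edge _ h (not_not.2 hq) (by simp) (.inr (s, q, d)) ⟨rfl, rfl⟩).1
  · obtain ⟨r, hr⟩ := exists_isAttractor_of_safety (B := B) hj
    exact not_not.1 (hr.forall_edge_notMem _ (not_not.2 h) ⟨_, rfl⟩ (.inr (s, q, d)) ⟨rfl, rfl⟩)

/-- Outside `Win₁`, the agents other than `j` have a positional strategy `g` against the goal of
`j`: it never leaves the complement of `Win₁`, and, if the comparator of `j` has to be driven into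
a rejecting sink, it decreases the distance `r` to that sink. -/
theorem exists_punishment [Nonempty (∀ i, A i)] (hB : G.IsGoalComparator j (B j)) :
    ∃ (g : V → Q j → ∀ i, A i) (r : V → Q j → ℕ), ∀ s q,
      Sum.inl (s, q) ∉ (G.deviationGame B j).Win₁ →
        (j ∈ G.cosafetyAgents → q ∉ (B j).accept) ∧
        ∀ d', (∀ i, i ≠ j → d' i = g s q i) →
          Sum.inl (G.τ s d', (B j).step q (G.letter j s d')) ∉ (G.deviationGame B j).Win₁ ∧
          (j ∉ G.cosafetyAgents → q ∈ (B j).accept →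
            r (G.τ s d') ((B j).step q (G.letter j s d')) < r s q) := by
  by_cases hj : j ∈ G.cosafetyAgents
  · obtain ⟨r, hr⟩ := exists_isAttractor_of_cosafety (B := B) hj
    have : ∀ s q, ∃ d, Sum.inl (s, q) ∉ (G.deviationGame B j).Win₁ →
        Sum.inr (s, q, d) ∉ (G.deviationGame B j).Win₁ := by
      intro s q
      by_cases h : Sum.inl (s, q) ∈ (G.deviationGame B j).Win₁
      · exact ⟨Classical.arbitrary _, fun h' => absurd h h'⟩
      · obtain ⟨p' | ⟨s', q', d⟩, he, hp'⟩ := hr.exists_edge_notMem _ h (by simp)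
        · exact he.elim
        · obtain ⟨rfl, rfl⟩ := he
          exact ⟨d, fun _ => hp'⟩
    choose g hg using this
    exact ⟨g, fun _ _ => 0, fun s q h => ⟨fun _ hq => h (hr.subset (not_not.2 hq)), fun d' hd =>
      ⟨notMem_win₁_of_inr hB (hg s q h) hd, fun hj' => absurd hj hj'⟩⟩⟩
  · obtain ⟨r, hr⟩ := exists_isAttractor_of_safety (B := B) hj
    have : ∀ s q, ∃ d, Sum.inl (s, q) ∉ (G.deviationGame B j).Win₁ → q ∈ (B j).accept →
        Sum.inr (s, q, d) ∉ (G.deviationGame B j).Win₁ ∧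
          r (.inr (s, q, d)) < r (.inl (s, q)) := by
      intro s q
      by_cases h : Sum.inl (s, q) ∉ (G.deviationGame B j).Win₁ ∧ q ∈ (B j).accept
      · obtain ⟨p' | ⟨s', q', d⟩, he, hp'⟩ := hr.exists_edge _ h.1 (not_not.2 h.2) ⟨_, rfl⟩
        · exact he.elim
        · obtain ⟨rfl, rfl⟩ := he
          exact ⟨d, fun _ _ => hp'⟩
      · exact ⟨Classical.arbitrary _, fun h1 h2 => absurd ⟨h1, h2⟩ h⟩
    choose g hg using this
    refine ⟨g, fun s q => r (.inl (s, q)), fun s q h => ⟨fun hj' => absurd hj' hj, fun d' hd => ?_⟩⟩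
    by_cases hq : q ∈ (B j).accept
    · obtain ⟨h1, h2⟩ := hg s q h hq
      have := hr.forall_edge _ h1 (not_not.2 hq) (by simp)
        (.inl (G.τ s d', (B j).step q (G.letter j s d'))) ⟨d', hd, rfl, rfl⟩
      exact ⟨this.1, fun _ _ => this.2.trans h2⟩
    · exact ⟨hr.subset (a := Sum.inl (_, _)) ((hB.isSafety hj).step_notMem hq _),
        fun _ h => absurd h hq⟩

/-- Inside `Win₁`, Agent `j` has a positional strategy `f` for her goal, as a function of the
state and the decision proposed to her: it never leaves `Win₁`, and, if her comparator has to be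
driven into an accepting sink, it decreases the distance `r` to that sink. -/
theorem exists_deviating_action [Nonempty (∀ i, A i)] (hB : G.IsGoalComparator j (B j)) :
    ∃ (f : V → Q j → (∀ i, A i) → A j) (r : V → Q j → (∀ i, A i) → ℕ), ∀ s q d,
      Sum.inr (s, q, d) ∈ (G.deviationGame B j).Win₁ →
        (j ∉ G.cosafetyAgents → q ∈ (B j).accept) ∧
        ∀ d', d' = Function.update d j (f s q d) → ∀ e,
          Sum.inr (G.τ s d', (B j).step q (G.letter j s d'), e) ∈ (G.deviationGame B j).Win₁ ∧
          (j ∈ G.cosafetyAgents → q ∉ (B j).accept →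
            (B j).step q (G.letter j s d') ∉ (B j).accept →
            r (G.τ s d') ((B j).step q (G.letter j s d')) e < r s q d) := by
  have update_eq : ∀ {d d' : ∀ i, A i}, (∀ i, i ≠ j → d' i = d i) →
      Function.update d j (d' j) = d' := by
    intro d d' h
    funext i
    by_cases hi : i = j
    · subst hi; simp
    · rw [Function.update_of_ne hi, h i hi]
  by_cases hj : j ∈ G.cosafetyAgents
  · obtain ⟨r, hr⟩ := exists_isAttractor_of_cosafety (B := B) hj
    have : ∀ s q d, ∃ a, Sum.inr (s, q, d) ∈ (G.deviationGame B j).Win₁ →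
        ∀ d', d' = Function.update d j a →
          Sum.inl (G.τ s d', (B j).step q (G.letter j s d')) ∈ (G.deviationGame B j).Win₁ ∧
          (q ∉ (B j).accept → r (.inl (G.τ s d', (B j).step q (G.letter j s d'))) <
            r (.inr (s, q, d))) := by
      intro s q d
      by_cases h : Sum.inr (s, q, d) ∈ (G.deviationGame B j).Win₁ ∧ q ∉ (B j).accept
      · obtain ⟨⟨s', q'⟩ | p', he, hp'⟩ := hr.exists_edge _ h.1 (not_not.2 h.2) ⟨_, rfl⟩
        · obtain ⟨d', hd, rfl, rfl⟩ := he
          refine ⟨d' j, fun _ e he => ?_⟩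
          rw [update_eq hd] at he
          subst he
          exact ⟨hp'.1, fun _ => hp'.2⟩
        · exact he.elim
      · refine ⟨d j, fun h1 d' _ => ?_⟩
        have hq : q ∈ (B j).accept := not_not.1 fun h2 => h ⟨h1, h2⟩
        exact ⟨hr.subset (a := Sum.inl (_, _)) (not_not.2 ((hB.isCoSafety hj).step_mem hq _)),
          fun h2 => absurd hq h2⟩
    choose f hf using this
    refine ⟨f, fun s q d => r (.inr (s, q, d)), fun s q d h => ⟨fun hj' => absurd hj hj',
      fun d' hd e => ?_⟩⟩
    obtain ⟨h1, h2⟩ := hf s q d h d' hd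
    refine ⟨mem_win₁_of_inl h1 e, fun _ hq hq' => lt_trans ?_ (h2 hq)⟩
    exact (hr.forall_edge _ h1 (not_not.2 hq') (by simp) (.inr (_, _, e)) ⟨rfl, rfl⟩).2
  · obtain ⟨r, hr⟩ := exists_isAttractor_of_safety (B := B) hj
    have : ∀ s q d, ∃ a, Sum.inr (s, q, d) ∈ (G.deviationGame B j).Win₁ →
        ∀ d', d' = Function.update d j a →
          Sum.inl (G.τ s d', (B j).step q (G.letter j s d')) ∈ (G.deviationGame B j).Win₁ := by
      intro s q d
      by_cases h : Sum.inr (s, q, d) ∈ (G.deviationGame B j).Win₁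
      · obtain ⟨⟨s', q'⟩ | p', he, hp'⟩ := hr.exists_edge_notMem _ (not_not.2 h) (by simp)
        · obtain ⟨d', hd, rfl, rfl⟩ := he
          refine ⟨d' j, fun _ e he => ?_⟩
          rw [update_eq hd] at he
          subst he
          exact not_not.1 hp'
        · exact he.elim
      · exact ⟨d j, fun h1 => absurd h1 h⟩
    choose f hf using this
    exact ⟨f, fun _ _ _ => 0, fun s q d h =>
      ⟨fun _ => not_not.1 fun hq => hr.subset (a := Sum.inr (_, _, _)) hq h, fun d' hd e =>
      ⟨mem_win₁_of_inl (hf s q d h d' hd) e, fun hj' => absurd hj' hj⟩⟩⟩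

end DeviationGame

/-! ### Comparators along a play -/

variable (B) in
/-- The state of the comparator of Agent `i` after the history `h`. -/
def compState (i : Fin k) (h : List (V × (∀ j, A j))) : Q i :=
  h.foldl (fun q e => (B i).step q (G.letter i e.1 e.2)) (B i).start

theorem compState_config_succ (π : G.Profile) (i : Fin k) (n : ℕ) :
    compState B i (G.config π (n + 1)).1 =
      (B i).step (compState B i (G.config π n).1)
        (G.letter i (G.config π n).2 (G.primaryTrace π n).2) := by
  simp [compState, config, primaryTrace]

theorem run_eq_compState (π : G.Profile) (i : Fin k) (n : ℕ) :
    (B i).run (fun n => G.letter i (G.primaryTrace π n).1 (G.primaryTrace π n).2) n =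
      compState B i (G.config π n).1 := by
  induction n with
  | zero => rfl
  | succ n ih => rw [DetBuchi.run, ih, compState_config_succ]; rfl

theorem satisfies_iff_accepts {i : Fin k} (hB : G.IsGoalComparator i (B i))
    (ρ : ℕ → V × (∀ j, A j)) :
    G.Satisfies i ρ ↔ (B i).toBuchi.Accepts fun n => G.letter i (ρ n).1 (ρ n).2 :=
  (hB.2.2 fun n => G.letter i (ρ n).1 (ρ n).2).symm

theorem satisfies_iff_frequently {i : Fin k} (hB : G.IsGoalComparator i (B i)) (π : G.Profile) :
    G.Satisfies i (G.primaryTrace π) ↔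
      ∃ᶠ n in atTop, compState B i (G.config π n).1 ∈ (B i).accept := by
  rw [satisfies_iff_accepts hB, DetBuchi.accepts_iff]
  simp only [run_eq_compState]

theorem satisfies_iff_of_safety {i : Fin k} (hB : G.IsGoalComparator i (B i))
    (hi : i ∉ G.cosafetyAgents) (π : G.Profile) :
    G.Satisfies i (G.primaryTrace π) ↔ ∀ n, compState B i (G.config π n).1 ∈ (B i).accept := by
  rw [satisfies_iff_accepts hB, (hB.isSafety hi).accepts_iff]
  simp only [run_eq_compState]

theorem satisfies_iff_of_cosafety {i : Fin k} (hB : G.IsGoalComparator i (B i))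
    (hi : i ∈ G.cosafetyAgents) (π : G.Profile) :
    G.Satisfies i (G.primaryTrace π) ↔ ∃ n, compState B i (G.config π n).1 ∈ (B i).accept := by
  rw [satisfies_iff_accepts hB, (hB.isCoSafety hi).accepts_iff]
  simp only [run_eq_compState]

/-! ### From equilibria to words -/

/-- If the play of `π` passes a position of the deviation game that Agent `j` wins, then she can
follow `π` up to there and deviate to a play on which her goal holds. -/
theorem exists_satisfying_deviation {j : Fin k} (hB : G.IsGoalComparator j (B j)) (π : G.Profile)
    (n : ℕ)
    (h : Sum.inr ((G.config π n).2, compState B j (G.config π n).1, (G.primaryTrace π n).2) ∈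
      (G.deviationGame B j).Win₁) :
    ∃ σ : G.Strategy j, G.Satisfies j (G.primaryTrace (Function.update π j σ)) := by
  have : Nonempty (∀ i, A i) := ⟨(G.primaryTrace π n).2⟩
  obtain ⟨f, r, hf⟩ := exists_deviating_action hB
  let σ : G.Strategy j := fun h s =>
    if h.length < n then π j h s else f s (compState B j h) fun i => π i h s
  let π' : G.Profile := Function.update π j σ
  refine ⟨σ, ?_⟩
  change G.Satisfies j (G.primaryTrace π')
  have hconf : ∀ m ≤ n, G.config π' m = G.config π m := by
    intro m hm
    induction m with
    | zero => rfl
    | succ m ih =>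
      have hd : (fun i => π' i (G.config π m).1 (G.config π m).2) =
          fun i => π i (G.config π m).1 (G.config π m).2 := by
        funext i
        by_cases hi : i = j
        · subst hi
          simp [π', σ, length_config, Nat.lt_of_succ_le hm]
        · simp [π', hi]
      simp only [config, ih (Nat.le_of_succ_le hm), hd]
  let e : ℕ → ∀ i, A i := fun m i => π i (G.config π' m).1 (G.config π' m).2
  let c : ℕ → Q j := fun m => compState B j (G.config π' m).1
  have hd : ∀ m, n ≤ m → (G.primaryTrace π' m).2 =
      Function.update (e m) j (f (G.config π' m).2 (c m) (e m)) := by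
    intro m hm
    funext i
    by_cases hi : i = j
    · subst hi
      simp [primaryTrace, π', σ, length_config, not_lt.2 hm, e, c]
    · simp [primaryTrace, π', hi, e]
  have hwin : ∀ m, n ≤ m →
      Sum.inr ((G.config π' m).2, c m, e m) ∈ (G.deviationGame B j).Win₁ := by
    intro m hm
    induction m, hm using Nat.le_induction with
    | base => simp only [c, e, hconf n le_rfl]; exact h
    | succ m hm ih =>
      have := ((hf _ _ _ ih).2 _ (hd m hm) (e (m + 1))).1
      rwa [← compState_config_succ] at this
  by_cases hj : j ∈ G.cosafetyAgents
  · rw [satisfies_iff_of_cosafety hB hj]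
    by_contra! hno
    refine not_strictAnti_of_wellFoundedLT
      (fun m => r (G.config π' (n + m)).2 (c (n + m)) (e (n + m)))
      (strictAnti_nat_of_succ_lt fun m => ?_)
    have := ((hf _ _ _ (hwin (n + m) (by omega))).2 _ (hd (n + m) (by omega)) (e (n + m + 1))).2
      hj (hno _)
    rw [← compState_config_succ] at this
    exact this (hno _)
  · rw [satisfies_iff_frequently hB]
    refine Eventually.frequently ((eventually_ge_atTop n).mono fun m hm => ?_)
    exact (hf _ _ _ (hwin m hm)).1 hj

/-- The play of a `W`-Nash equilibrium is accepted: a position of it in `Win₁` would give an agent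
outside `W` a profitable deviation. -/
theorem language_nonempty_of_isWNash {W : Set (Fin k)} (hB : ∀ i, G.IsGoalComparator i (B i))
    {π : G.Profile} (hπ : G.IsWNash W π) : (G.restrictedAutomaton B W).language.Nonempty := by
  have hsat : ∀ i, G.Satisfies i (G.primaryTrace π) ↔ i ∈ W := fun i => by rw [← hπ.2]; rfl
  let c : ℕ → ∀ i, Q i := fun n i => compState B i (G.config π n).1
  have hcs : ∀ n i, c (n + 1) i = (B i).step (c n i)
      (G.letter i (G.config π n).2 (G.primaryTrace π n).2) :=
    fun n i => compState_config_succ π i n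
  have : Nonempty (∀ i, A i) := ⟨(G.primaryTrace π 0).2⟩
  have hinr : ∀ n, ∀ j ∉ W, Sum.inr ((G.config π n).2, c n j, (G.primaryTrace π n).2) ∉
      (G.deviationGame B j).Win₁ := by
    intro n j hj h
    obtain ⟨σ, hσ⟩ := exists_satisfying_deviation (hB j) π n h
    exact hπ.1 j σ ⟨hσ, fun h => hj ((hsat j).1 h)⟩
  have hinl : ∀ n, ∀ j ∉ W, Sum.inl ((G.config π n).2, c n j) ∉ (G.deviationGame B j).Win₁ :=
    fun n j hj h => hinr n j hj (mem_win₁_of_inl h _)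
  -- The sets `S₁`, `S₂` of the run, written as a function of the comparator states.
  let S₁ : ℕ → Set (Fin k) :=
    fun n => {i ∈ W ∩ G.cosafetyAgents | ∀ m < n, c (m + 1) i ∉ (B i).accept}
  let S₂ : ℕ → Set (Fin k) :=
    fun n => {i ∈ Wᶜ ∩ G.safetyAgents | ∀ m < n, c (m + 1) i ∈ (B i).accept}
  refine ⟨fun n => (G.primaryTrace π n).2, fun n => ((G.config π n).2, c n, S₁ n, S₂ n),
    ⟨?_, fun n => ⟨⟨rfl, hcs n, ?_, ?_, ?_, ?_⟩, hinl n, hinl (n + 1), hinr n⟩⟩, ?_⟩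
  · change _ = (G.init, (fun i => (B i).start), W ∩ G.cosafetyAgents, Wᶜ ∩ G.safetyAgents)
    simp [S₁, S₂, c, config, compState, Set.ext_iff]
  · ext i
    simp only [S₁, Set.mem_sep_iff, Nat.forall_lt_succ_right, and_assoc]
  · ext i
    simp only [S₂, Set.mem_sep_iff, Nat.forall_lt_succ_right, and_assoc]
  · rintro i ⟨hi, his⟩
    exact (satisfies_iff_of_safety (hB i) (not_not.2 his) π).1 ((hsat i).2 hi) (n + 1)
  · rintro i ⟨hi, hic⟩ h
    exact hi ((hsat i).1 ((satisfies_iff_of_cosafety (hB i) hic π).2 ⟨n + 1, h⟩))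
  · rw [BuchiAutomaton.infSet_inter_nonempty_iff]
    have : ∀ i, ∀ᶠ n in atTop, i ∉ S₁ n ∧ i ∉ S₂ n := by
      intro i
      by_cases hi : i ∈ W <;> by_cases hic : i ∈ G.cosafetyAgents
      · obtain ⟨n, hn⟩ := (satisfies_iff_of_cosafety (hB i) hic π).1 ((hsat i).2 hi)
        -- The sets record the comparator only from the first move on, so one more move is needed.
        have hn' : c (n + 1) i ∈ (B i).accept := by
          rw [hcs]; exact ((hB i).isCoSafety hic).step_mem hn _
        exact (eventually_gt_atTop n).mono fun m hm => ⟨fun h => h.2 n hm hn', fun h => h.1.1 hi⟩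
      · exact Eventually.of_forall fun n => ⟨fun h => hic h.1.2, fun h => h.1.1 hi⟩
      · exact Eventually.of_forall fun n => ⟨fun h => hi h.1.1, fun h => hic h.1.2⟩
      · have := mt (hsat i).1 hi
        rw [satisfies_iff_of_safety (hB i) hic π] at this
        push Not at this
        obtain ⟨n, hn⟩ := this
        have hn' : c (n + 1) i ∉ (B i).accept := by
          rw [hcs]; exact ((hB i).isSafety hic).step_notMem hn _
        exact (eventually_gt_atTop n).mono fun m hm => ⟨fun h => hi h.1.1, fun h => hn' (h.2 n hm)⟩
    refine Eventually.frequently ((eventually_all.2 this).mono fun n hn => ⟨?_, ?_⟩)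
    · exact Set.eq_empty_of_forall_notMem fun i => (hn i).1
    · exact Set.eq_empty_of_forall_notMem fun i => (hn i).2

/-! ### From words to equilibria -/

variable (B) in
/-- The profile that plays the decisions `x`, and after a departure of Agent `j` from them
the punishing decisions `g j`. -/
noncomputable def trigger (x : ℕ → ∀ i, A i) (g : ∀ j, V → Q j → ∀ i, A i) : G.Profile :=
  fun i h s =>
    match deviator x h with
    | none => x h.length i
    | some j => g j s (compState B j h) i

/-- The transitions of `A_W` in terms of projections instead of pattern matching. -/
theorem productAutomaton_trans {W : Set (Fin k)} {p p' : ProductState V Q} {d : ∀ i, A i}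
    (h : (G.productAutomaton B W).trans p d p') :
    p'.1 = G.τ p.1 d ∧
    (∀ i, p'.2.1 i = (B i).step (p.2.1 i) (G.letter i p.1 d)) ∧
    p'.2.2.1 = {i ∈ p.2.2.1 | p'.2.1 i ∉ (B i).accept} ∧
    p'.2.2.2 = {i ∈ p.2.2.2 | p'.2.1 i ∈ (B i).accept} ∧
    (∀ i ∈ W ∩ G.safetyAgents, p'.2.1 i ∈ (B i).accept) ∧
    (∀ i ∈ Wᶜ ∩ G.cosafetyAgents, p'.2.1 i ∉ (B i).accept) :=
  h

/-- The profile that follows an accepted word and punishes the first departure from it is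
a `W`-Nash equilibrium. -/
theorem exists_isWNash_of_language_nonempty {W : Set (Fin k)}
    (hB : ∀ i, G.IsGoalComparator i (B i)) (h : (G.restrictedAutomaton B W).language.Nonempty) :
    ∃ π : G.Profile, G.IsWNash W π := by
  obtain ⟨x, r, ⟨hr0, hr⟩, hacc⟩ := h
  rw [BuchiAutomaton.infSet_inter_nonempty_iff] at hacc
  obtain ⟨N, hN₁, hN₂⟩ := hacc.exists
  have : Nonempty (∀ i, A i) := ⟨x 0⟩
  let q : ℕ → ∀ i, Q i := fun n => (r n).2.1
  have htrans := fun n => productAutomaton_trans (hr n).1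
  have hWsafe : ∀ i ∈ W, i ∉ G.cosafetyAgents → ∀ n, q (n + 1) i ∈ (B i).accept :=
    fun i hi hic n => (htrans n).2.2.2.2.1 i ⟨hi, not_not.1 hic⟩
  have hWco : ∀ i ∈ W, i ∈ G.cosafetyAgents → ∃ n, q n i ∈ (B i).accept := by
    intro i hi hic
    by_contra! hno
    have : ∀ n, i ∈ (r n).2.2.1 := by
      intro n
      induction n with
      | zero => rw [hr0]; exact ⟨hi, hic⟩
      | succ n ih => rw [(htrans n).2.2.1]; exact ⟨ih, hno _⟩
    exact Set.notMem_empty i (hN₁ ▸ this N)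
  have hsafe : ∀ i ∉ W, i ∉ G.cosafetyAgents → ∃ n, q n i ∉ (B i).accept := by
    intro i hi hic
    by_contra! hno
    have : ∀ n, i ∈ (r n).2.2.2 := by
      intro n
      induction n with
      | zero => rw [hr0]; exact ⟨hi, not_not.1 hic⟩
      | succ n ih => rw [(htrans n).2.2.2.1]; exact ⟨ih, hno _⟩
    exact Set.notMem_empty i (hN₂ ▸ this N)
  choose g d hg using fun j => exists_punishment (hB j)
  let π : G.Profile := trigger B x g
  -- The play of `ρ` has followed the word `x` for `n` rounds.
  let OnTrack : G.Profile → ℕ → Prop := fun ρ n => deviator x (G.config ρ n).1 = none ∧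
    (G.config ρ n).2 = (r n).1 ∧ ∀ i, compState B i (G.config ρ n).1 = q n i
  have htrack0 : ∀ ρ, OnTrack ρ 0 := fun ρ => ⟨rfl, by rw [hr0]; rfl, fun i => by
    simp only [q]; rw [hr0]; rfl⟩
  have htrack : ∀ ρ n, OnTrack ρ n → (G.primaryTrace ρ n).2 = x n → OnTrack ρ (n + 1) := by
    rintro ρ n ⟨h1, h2, h3⟩ hx
    refine ⟨deviator_append_of_eq h1 (by rw [length_config]; exact hx), ?_, fun i => ?_⟩
    · rw [(htrans n).1, ← h2, ← hx]; rfl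
    · rw [compState_config_succ, h3, h2, hx]
      exact ((htrans n).2.1 i).symm
  have hfollow : ∀ ρ n, OnTrack ρ n → ∀ i, ρ i = π i → (G.primaryTrace ρ n).2 i = x n i := by
    rintro ρ n ⟨h1, -, -⟩ i hi
    simp only [primaryTrace, hi, π, trigger, h1, length_config]
  have hpunish : ∀ ρ n j, deviator x (G.config ρ n).1 = some j → ∀ i, ρ i = π i →
      (G.primaryTrace ρ n).2 i = g j (G.config ρ n).2 (compState B j (G.config ρ n).1) i := by
    intro ρ n j h1 i hi
    simp only [primaryTrace, hi, π, trigger, h1]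
  have hon : ∀ n, OnTrack π n := fun n => Nat.rec (htrack0 π)
    (fun n ih => htrack π n ih (funext fun i => hfollow π n ih i rfl)) n
  -- No agent outside `W` gets her goal, even if she departs from `π`.
  have hlose : ∀ j ∉ W, ∀ ρ : G.Profile, (∀ i, i ≠ j → ρ i = π i) →
      ¬ G.Satisfies j (G.primaryTrace ρ) := by
    intro j hj ρ hρ
    let c : ℕ → Q j := fun n => compState B j (G.config ρ n).1
    have hpun : ∀ n, deviator x (G.config ρ n).1 = some j → ∀ i, i ≠ j →
        (G.primaryTrace ρ n).2 i = g j (G.config ρ n).2 (c n) i :=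
      fun n h i hi => hpunish ρ n j h i (hρ i hi)
    have hinv : ∀ n, (OnTrack ρ n ∨ deviator x (G.config ρ n).1 = some j) ∧
        Sum.inl ((G.config ρ n).2, c n) ∉ (G.deviationGame B j).Win₁ := by
      intro n
      induction n with
      | zero =>
        refine ⟨.inl (htrack0 ρ), ?_⟩
        obtain ⟨-, h2, h3⟩ := htrack0 ρ
        simp only [c, h2, h3]
        exact (hr 0).2.1 j hj
      | succ n ih =>
        rcases ih with ⟨hn | hn, hwin⟩
        · have hx : ∀ i, i ≠ j → (G.primaryTrace ρ n).2 i = x n i :=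
            fun i hi => hfollow ρ n hn i (hρ i hi)
          constructor
          · by_cases hxn : (G.primaryTrace ρ n).2 = x n
            · exact .inl (htrack ρ n hn hxn)
            · refine .inr (deviator_append_of_ne hn.1 ?_ ?_)
              · rw [length_config]; exact hxn
              · rw [length_config]; exact hx
          -- The word reads no decision at which `j` could move into `Win₁`.
          · have := notMem_win₁_of_inr (hB j) ((hr n).2.2.2 j hj) hx
            simp only [c]
            rw [compState_config_succ, hn.2.1, hn.2.2]
            rw [← hn.2.1] at this ⊢
            exact this
        · refine ⟨.inr (deviator_append_of_some hn), ?_⟩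
          have := (((hg j) _ _ hwin).2 _ (hpun n hn)).1
          rwa [← compState_config_succ] at this
    by_cases hjc : j ∈ G.cosafetyAgents
    · rw [satisfies_iff_of_cosafety (hB j) hjc]
      rintro ⟨n, hn⟩
      exact ((hg j) _ _ (hinv n).2).1 hjc hn
    · rw [satisfies_iff_of_safety (hB j) hjc]
      intro hall
      -- Without a departure the acceptance of the word makes the comparator reject; after one,
      -- the punishment decreases the distance to the rejecting sink.
      by_cases htr : ∀ n, OnTrack ρ n
      · obtain ⟨n, hn⟩ := hsafe j hj hjc
        exact hn ((htr n).2.2 j ▸ hall n)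
      · push Not at htr
        obtain ⟨n, hn⟩ := htr
        have hdev : ∀ m, deviator x (G.config ρ (n + m)).1 = some j := by
          intro m
          induction m with
          | zero => exact (hinv n).1.resolve_left hn
          | succ m ih => exact deviator_append_of_some ih
        refine not_strictAnti_of_wellFoundedLT (fun m => d j (G.config ρ (n + m)).2 (c (n + m)))
          (strictAnti_nat_of_succ_lt fun m => ?_)
        have := (((hg j) _ _ (hinv (n + m)).2).2 _ (hpun _ (hdev m))).2 hjc (hall _)
        rwa [← compState_config_succ] at this
  have hgain : ∀ i ∈ W, G.Satisfies i (G.primaryTrace π) := by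
    intro i hi
    have hc : ∀ n, compState B i (G.config π n).1 = q n i := fun n => (hon n).2.2 i
    by_cases hic : i ∈ G.cosafetyAgents
    · rw [satisfies_iff_of_cosafety (hB i) hic]
      simpa only [hc] using hWco i hi hic
    · rw [satisfies_iff_frequently (hB i)]
      refine Eventually.frequently ((eventually_ge_atTop 1).mono fun n hn => ?_)
      obtain ⟨m, rfl⟩ := Nat.exists_eq_add_of_le' hn
      rw [hc]
      exact hWsafe i hi hic m
  refine ⟨π, fun i σ hpref => ?_, ?_⟩
  · by_cases hi : i ∈ W
    · exact hpref.2 (hgain i hi)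
    · exact hlose i hi _ (fun i' hi' => Function.update_of_ne hi' σ π) hpref.1
  · ext i
    refine ⟨fun hs => ?_, hgain i⟩
    by_contra hi
    exact hlose i hi π (fun _ _ => rfl) hs

end SatisficingGame

end Satisficing

theorem theorem3 {V : Type*} [Fintype V] {k : ℕ} {A : Fin k → Type*} [∀ i, Fintype (A i)]
    (G : Satisficing.SatisficingGame V k A) (W : Set (Fin k)) :
    (∀ i : Fin k, ∃ (S : Type) (_ : Finite S)
      (M : Satisficing.DetBuchi (Satisficing.Weights (G.maxReward i)) S),
        G.IsGoalComparator i M) ∧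
    ∀ (Q : Fin k → Type*) [∀ i, Finite (Q i)]
      (B : ∀ i, Satisficing.DetBuchi (Satisficing.Weights (G.maxReward i)) (Q i)),
      (∀ i, G.IsGoalComparator i (B i)) →
      ((G.restrictedAutomaton B W).language.Nonempty ↔
        ∃ π : G.Profile, G.IsWNash W π) :=
  ⟨fun i => Satisficing.exists_comparator G.one_lt_γ (G.maxReward i) (G.rel i) (G.threshold i),
    fun _ _ _ hB => ⟨fun h =>
      Satisficing.SatisficingGame.exists_isWNash_of_language_nonempty hB h, fun ⟨_, hπ⟩ =>
      Satisficing.SatisficingGame.language_nonempty_of_isWNash hB hπ⟩⟩
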